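/- Let $\sigma>0$ and $1\le p\le\infty$. Let $B_\sigma^p$ denote the space of all complex-valued functions $f\in L^p(\mathbb{R})\cap C^\infty(\mathbb{R})$ whose distributional Fourier transform $\mathcal{F}f$, defined by $\langle \mathcal{F}f,\varphi\rangle=\int_{\mathbb{R}} f(x)\,\mathcal{F}\varphi(x)\,dx$ for Schwartz functions $\varphi$, with $\mathcal{F}\varphi(\xi)=\frac{1}{\sqrt{2\pi}}\int_{\mathbb{R}}\varphi(x)e^{-ix\xi}\,dx$, is supported in $[-\sigma,\sigma]$. Let $\operatorname{sinc}x=\frac{\sin \pi x}{\pi x}$ for $x\neq 0$ and $\operatorname{sinc}0=1$, and for $m\in\mathbb{N}=\{1,2,\dots\}$ put $$A_{m,k}=(-1)^{k+1}\operatorname{sinc}^{(2m-1)}\left(\tfrac12-k\right)\quad(k\in\mathbb{Z}),$$ $$B_{m,k}=(-1)^{k+1}\operatorname{sinc}^{(2m)}(-k)\quad(k\in\mathbb{Z}\setminus\{0\}),\qquad B_{m,0}=(-1)^{m+1}\frac{\pi^{2m}}{2m+1}.$$ 1. For every $f\in B_\sigma^\infty$, $m\in\mathbb{N}$ and $x\in\mathbb{R}$,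 $$f^{(2m-1)}(x)=\left(\frac{\sigma}{\pi}\right)^{2m-1}\sum_{k\in\mathbb{Z}}(-1)^{k+1}A_{m,k}\,f\left(x+\frac{\pi}{\sigma}\left(k-\tfrac12\right)\right),$$ $$f^{(2m)}(x)=\left(\frac{\sigma}{\pi}\right)^{2m}\sum_{k\in\mathbb{Z}}(-1)^{k+1}B_{m,k}\,f\left(x+\frac{\pi}{\sigma}k\right),$$ where both series converge absolutely. 2. For every $f\in B_\sigma^p$, $1\le p\le\infty$, and every $m\in\mathbb{N}$, the right-hand sides above, regarded as series of functions of $x$, converge (unconditionally) in the norm of $L^p(\mathbb{R})$ to $f^{(2m-1)}$ and $f^{(2m)}$ respectively. 3. For every $f\in B_\sigma^p$, $1\le p\le\infty$, and every integer $n\ge 0$, one has $f^{(n)}\in L^p(\mathbb{R})$ and the Bernstein inequality $\|f^{(n)}\|_p\le\sigma^n\|f\|_p$. -/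

import Mathlib

open Real Set Filter Topology MeasureTheory
open scoped ENNReal SchwartzMap ContDiff

noncomputable section

/-- The unitary Fourier transform with angular frequency,
`(2π)^(-1/2) ∫ φ(x) e^{-i x ξ} dx`. -/
def angularFourier (φ : ℝ → ℂ) (ξ : ℝ) : ℂ :=
  ((1 / √(2 * π) : ℝ) : ℂ) * ∫ x : ℝ, φ x * Complex.exp (-(Complex.I * x * ξ))

/-- The distributional Fourier transform of `f`, as a functional on Schwartz functions:
the pairing of `f` with the Fourier transform of the test function. -/
def distFourier (f : ℝ → ℂ) (φ : 𝓢(ℝ, ℂ)) : ℂ :=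
  ∫ x : ℝ, f x * angularFourier φ x

/-- The Bernstein space with parameters `σ` and `p`: smooth functions in `L^p` of the line whose
distributional Fourier transform is supported in `[-σ, σ]`, that is, vanishes on all test
functions whose support lies in the complement of `[-σ, σ]`. -/
structure MemBernstein (σ : ℝ) (p : ℝ≥0∞) (f : ℝ → ℂ) : Prop where
  memLp : MemLp f p volume
  contDiff : ContDiff ℝ ∞ f
  fourier_support : Distribution.IsVanishingOn (distFourier f) (Icc (-σ) σ)ᶜ

/-- The normalized cardinal sine, `sin (π x) / (π x)` for `x ≠ 0` and `1` at `0`. -/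
def normSinc (x : ℝ) : ℝ := Real.sinc (π * x)

/-- The coefficients of the formula for odd derivatives. -/
def coeffA (m : ℕ) (k : ℤ) : ℝ :=
  (-1) ^ (k + 1) * iteratedDeriv (2 * m - 1) normSinc (1 / 2 - (k : ℝ))

/-- The coefficients of the formula for even derivatives. -/
def coeffB (m : ℕ) (k : ℤ) : ℝ :=
  if k = 0 then (-1) ^ (m + 1) * (π ^ (2 * m) / (2 * (m : ℝ) + 1))
  else (-1) ^ (k + 1) * iteratedDeriv (2 * m) normSinc (-(k : ℝ))

/-- The `k`-th term of the series for the derivative of order `2 m - 1`. -/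
def oddTerm (σ : ℝ) (m : ℕ) (f : ℝ → ℂ) (k : ℤ) (x : ℝ) : ℂ :=
  (-1) ^ (k + 1) * (coeffA m k : ℂ) * f (x + π / σ * ((k : ℝ) - 1 / 2))

/-- The `k`-th term of the series for the derivative of order `2 m`. -/
def evenTerm (σ : ℝ) (m : ℕ) (f : ℝ → ℂ) (k : ℤ) (x : ℝ) : ℂ :=
  (-1) ^ (k + 1) * (coeffB m k : ℂ) * f (x + π / σ * (k : ℝ))

end

/-! Choose `δ` with `exp (2πiδ) = (-1)^n`. Then `(it)^n * exp (iδt)` takes equal values at `±π`, so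
it extends to a continuous `2π`-periodic function. Its Fourier coefficients are `c_k = sinc⁽ⁿ⁾(δ -
k)`, and they decay quadratically. Hence `(it)^n = ∑ c_k exp (it(k - δ))` on `[-π, π]`
(`hasSum_sincCoeff_mul_exp`). Rescaled to a band `[-a, a]`, this says that differentiating `n` times
is a series of translations. The shifts `δ = 1/2` and `δ = 0` give the odd and even formulas.

For general `f` the spectrum is only a distribution. So `f` is written as `f * K` with `K` Schwartz
and band-limited to `[-s, s]`, `s > σ` (`MemBernstein.exists_reproducing_kernel`). The formula at
rate `s` passes from `K` to `f`, and `s ↓ σ` gives the critical rate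
(`MemBernstein.hasSum_sincCoeff`).

The numbers `i^n exp (iπ(δ - k)) c_k` are all nonnegative, so the expansion at `t = -π` yields `∑
|c_k| = π^n` (`tsum_abs_sincCoeff`). Minkowski's inequality then gives the Bernstein constant `σ^n`,
and the tails of the same series give norm convergence. -/

/-! ### Derivatives of sinc as Fourier integrals. -/

/-- The `n`-th derivative in `y` of `∫ v in -a..a, χ v * exp (i v y)`. -/
noncomputable def bandIntegral (χ : ℝ → ℂ) (a : ℝ) (n : ℕ) (y : ℝ) : ℂ :=
  ∫ v in (-a)..a, χ v * (Complex.I * v) ^ n * Complex.exp (Complex.I * v * y)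

theorem norm_exp_I_mul_mul (v y : ℝ) : ‖Complex.exp (Complex.I * v * y)‖ = 1 := by
  rw [show Complex.I * v * y = ((v * y : ℝ) : ℂ) * Complex.I by push_cast; ring]
  exact Complex.norm_exp_ofReal_mul_I _

theorem bandIntegral_hasDerivAt {χ : ℝ → ℂ} (hχ : Continuous χ) (a : ℝ) (n : ℕ) (y : ℝ) :
    HasDerivAt (bandIntegral χ a n) (bandIntegral χ a (n + 1) y) y := by
  refine (intervalIntegral.hasDerivAt_integral_of_dominated_loc_of_deriv_le
    (F := fun y v : ℝ => χ v * (Complex.I * v) ^ n * Complex.exp (Complex.I * v * y))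
    (F' := fun y v : ℝ => χ v * (Complex.I * v) ^ (n + 1) * Complex.exp (Complex.I * v * y))
    (bound := fun v => ‖χ v * (Complex.I * v) ^ (n + 1)‖) (s := univ) univ_mem ?_ ?_ ?_ ?_ ?_ ?_).2
  · exact .of_forall fun x => (by fun_prop : Continuous _).aestronglyMeasurable
  · exact (by fun_prop : Continuous _).intervalIntegrable _ _
  · exact (by fun_prop : Continuous _).aestronglyMeasurable
  · refine .of_forall fun v _ x _ => ?_
    rw [norm_mul _ (Complex.exp _), norm_exp_I_mul_mul, mul_one]
  · exact (by fun_prop : Continuous _).intervalIntegrable _ _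
  · refine .of_forall fun v _ x _ => ?_
    have h1 : HasDerivAt (fun x : ℝ => Complex.I * v * x) (Complex.I * v * 1) x :=
      (Complex.ofRealCLM.hasDerivAt (x := x)).const_mul _
    exact (h1.cexp.const_mul (χ v * (Complex.I * v) ^ n)).congr_deriv (by ring)

theorem normSinc_eq_bandIntegral (y : ℝ) :
    (normSinc y : ℂ) = (2 * (π : ℂ))⁻¹ * bandIntegral (fun _ => 1) π 0 y := by
  have hπ : (π : ℂ) ≠ 0 := by exact_mod_cast Real.pi_ne_zero
  rcases eq_or_ne y 0 with rfl | hy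
  · simp only [normSinc, bandIntegral, mul_zero, sinc_zero, Complex.ofReal_one, pow_zero, mul_one,
      Complex.ofReal_zero, Complex.exp_zero, intervalIntegral.integral_const, sub_neg_eq_add]
    rw [Complex.real_smul]
    push_cast
    field_simp
    ring
  · have hy' : (y : ℂ) ≠ 0 := by exact_mod_cast hy
    have h := integral_exp_mul_I_eq_sinc (π * y)
    have h2 := intervalIntegral.integral_comp_mul_right (a := -π) (b := π)
      (fun t : ℝ => Complex.exp (t * Complex.I)) hy
    rw [neg_mul, h, Complex.real_smul] at h2
    have h3 : bandIntegral (fun _ => 1) π 0 y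
        = ∫ x in (-π)..π, Complex.exp ((x * y : ℝ) * Complex.I) := by
      unfold bandIntegral
      congr 1 with v
      push_cast
      rw [pow_zero, one_mul, one_mul]
      ring_nf
    rw [h3, h2, normSinc]
    push_cast
    field_simp

theorem iteratedDeriv_normSinc (n : ℕ) (y : ℝ) :
    ((iteratedDeriv n normSinc y : ℝ) : ℂ) = (2 * (π : ℂ))⁻¹ * bandIntegral (fun _ => 1) π n y := by
  induction n generalizing y with
  | zero => simpa using normSinc_eq_bandIntegral y
  | succ n ih =>
    have h := (bandIntegral_hasDerivAt (χ := fun _ => 1) continuous_const π n y).const_mul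
      (2 * (π : ℂ))⁻¹
    rw [← funext ih] at h
    -- The real derivative is recovered from the complex identity: the imaginary part is identically
    -- zero, so its derivative vanishes too.
    have hre := Complex.reCLM.hasFDerivAt.comp_hasDerivAt y h
    have him := Complex.imCLM.hasFDerivAt.comp_hasDerivAt y h
    have e1 : (Complex.reCLM ∘ fun y => ((iteratedDeriv n normSinc y : ℝ) : ℂ))
        = iteratedDeriv n normSinc := by ext; simp
    have e2 : (Complex.imCLM ∘ fun y => ((iteratedDeriv n normSinc y : ℝ) : ℂ)) = fun _ => 0 := by
      ext; simp
    rw [e1] at hre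
    rw [e2] at him
    have h0 := him.unique (hasDerivAt_const y (0 : ℝ))
    rw [iteratedDeriv_succ, hre.deriv]
    apply Complex.ext
    · simp
    · simpa using h0.symm

/-- Moving the modulus inside the integral keeps the factor `1 / (n + 1)`, which the sign argument
at the nodes needs exactly. -/
theorem norm_bandIntegral_one_le (n : ℕ) (y : ℝ) :
    ‖bandIntegral (fun _ => 1) π n y‖ ≤ 2 * π ^ (n + 1) / (n + 1) := by
  have h1 : ‖bandIntegral (fun _ => 1) π n y‖ ≤ ∫ v in (-π)..π, |v| ^ n := by
    refine intervalIntegral.norm_integral_le_of_norm_le (by linarith [pi_pos]) ?_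
      ((by fun_prop : Continuous _).intervalIntegrable _ _)
    refine .of_forall fun v _ => ?_
    rw [norm_mul, norm_exp_I_mul_mul]
    simp
  refine h1.trans (le_of_eq ?_)
  rw [← intervalIntegral.integral_add_adjacent_intervals (b := 0)
    ((by fun_prop : Continuous _).intervalIntegrable _ _)
    ((by fun_prop : Continuous _).intervalIntegrable _ _)]
  have h2 : ∫ v in (0 : ℝ)..π, |v| ^ n = π ^ (n + 1) / (n + 1) := by
    rw [intervalIntegral.integral_congr (g := fun v => v ^ n), integral_pow]
    · simp
    · intro v hv
      rw [uIcc_of_le pi_pos.le] at hv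
      simp [abs_of_nonneg hv.1]
  have h3 : ∫ v in (-π)..0, |v| ^ n = ∫ v in (0 : ℝ)..π, |v| ^ n := by
    have := intervalIntegral.integral_comp_neg (a := 0) (b := π) (fun v : ℝ => |v| ^ n)
    simpa using this.symm
  rw [h3, h2]
  ring

/-! ### Decay and signs of the coefficients. -/

theorem bandIntegral_one_by_parts (n : ℕ) (y : ℝ) :
    Complex.I * y * bandIntegral (fun _ => 1) π n y
      = (Complex.I * π) ^ n * Complex.exp (Complex.I * π * y)
        - (-(Complex.I * π)) ^ n * Complex.exp (-(Complex.I * π * y))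
        - n * Complex.I * bandIntegral (fun _ => 1) π (n - 1) y := by
  have hd : ∀ v : ℝ, HasDerivAt
      (fun v : ℝ => (Complex.I * v) ^ n * Complex.exp (Complex.I * v * y))
      (n * Complex.I * (1 * (Complex.I * v) ^ (n - 1) * Complex.exp (Complex.I * v * y))
        + Complex.I * y * (1 * (Complex.I * v) ^ n * Complex.exp (Complex.I * v * y))) v := by
    intro v
    have h1 : HasDerivAt (fun v : ℝ => Complex.I * (v : ℂ)) (Complex.I * 1) v :=
      (Complex.ofRealCLM.hasDerivAt (x := v)).const_mul _
    exact ((h1.fun_pow n).mul (h1.mul_const (y : ℂ)).cexp).congr_deriv (by ring)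
  have h := intervalIntegral.integral_eq_sub_of_hasDerivAt (a := -π) (b := π) (fun v _ => hd v)
    ((by fun_prop : Continuous _).intervalIntegrable _ _)
  rw [intervalIntegral.integral_add ((by fun_prop : Continuous _).intervalIntegrable _ _)
    ((by fun_prop : Continuous _).intervalIntegrable _ _),
    intervalIntegral.integral_const_mul, intervalIntegral.integral_const_mul] at h
  unfold bandIntegral
  rw [eq_sub_iff_add_eq, add_comm, h]
  push_cast
  ring_nf

/-- At the points where the boundary terms of the first integration by parts cancel, two
integrations by parts leave a quadratically decaying expression. -/
theorem sq_mul_bandIntegral_one (N : ℕ) {y : ℝ}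
    (hy : Complex.exp (2 * π * Complex.I * y) = (-1) ^ (N + 1)) :
    (y : ℂ) ^ 2 * bandIntegral (fun _ => 1) π (N + 1) y
      = (N + 1) * (2 * π ^ N * (Complex.I ^ (N + 1) * Complex.exp (Complex.I * π * y))
        + N * bandIntegral (fun _ => 1) π (N - 1) y) := by
  have h1 := bandIntegral_one_by_parts (N + 1) y
  have h0 := bandIntegral_one_by_parts N y
  set e := Complex.exp (Complex.I * π * y) with he
  have hneg : Complex.exp (-(Complex.I * π * y)) = (-1) ^ (N + 1) * e := by
    have h2 : e = Complex.exp (2 * π * Complex.I * y) * Complex.exp (-(Complex.I * π * y)) := by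
      rw [he, ← Complex.exp_add]; ring_nf
    rw [hy] at h2
    rw [h2, ← mul_assoc, ← mul_pow]
    simp
  rw [hneg] at h0 h1
  have hs : ∀ k : ℕ, ((-1 : ℂ) ^ k) * (-1) ^ k = 1 := fun k => by rw [← mul_pow]; simp
  rw [neg_pow (Complex.I * π) (N + 1)] at h1
  rw [neg_pow (Complex.I * π) N] at h0
  -- The boundary terms of order `N + 1` cancel; those of order `N` have the opposite parity and add
  -- up.
  have e1 : (-1 : ℂ) ^ (N + 1) * (Complex.I * π) ^ (N + 1) * ((-1) ^ (N + 1) * e)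
      = (Complex.I * π) ^ (N + 1) * e := by linear_combination (Complex.I * π) ^ (N + 1) * e * hs (N + 1)
  have e0 : (-1 : ℂ) ^ N * (Complex.I * π) ^ N * ((-1) ^ (N + 1) * e)
      = -((Complex.I * π) ^ N * e) := by
    rw [pow_succ]; linear_combination - (Complex.I * π) ^ N * e * hs N
  rw [e1, sub_self, zero_sub, Nat.add_sub_cancel] at h1
  rw [e0] at h0
  push_cast at h1
  have hI := Complex.I_mul_I
  have h1' : (y : ℂ) * bandIntegral (fun _ => 1) π (N + 1) y
      = -(N + 1) * bandIntegral (fun _ => 1) π N y := by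
    linear_combination -Complex.I * h1 + ((y : ℂ) * bandIntegral (fun _ => 1) π (N + 1) y
      + (N + 1) * bandIntegral (fun _ => 1) π N y) * hI
  rw [mul_pow] at h0
  rw [pow_succ Complex.I]
  linear_combination (y : ℂ) * h1' + (N + 1) * Complex.I * h0 - (N + 1) * (y *
    bandIntegral (fun _ => 1) π N y + N * bandIntegral (fun _ => 1) π (N - 1) y) * hI

theorem iteratedDeriv_even_normSinc_zero (m : ℕ) :
    iteratedDeriv (2 * m) normSinc 0 = (-1) ^ m * (π ^ (2 * m) / (2 * (m : ℝ) + 1)) := by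
  have h := iteratedDeriv_normSinc (2 * m) 0
  have h2 : bandIntegral (fun _ => 1) π (2 * m) 0
      = (-1) ^ m * ((2 * π * (π ^ (2 * m) / (2 * m + 1)) : ℝ) : ℂ) := by
    have : bandIntegral (fun _ => 1) π (2 * m) 0
        = ∫ v in (-π)..π, (-1 : ℂ) ^ m * ((v ^ (2 * m) : ℝ) : ℂ) := by
      unfold bandIntegral
      congr 1 with v
      rw [mul_pow, pow_mul Complex.I, Complex.I_sq]
      simp
    rw [this, intervalIntegral.integral_const_mul, intervalIntegral.integral_ofReal, integral_pow,
      pow_succ (-π), pow_mul (-π), neg_sq, ← pow_mul, pow_succ]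
    congr 2
    push_cast
    ring
  rw [h2] at h
  have hπ : (π : ℂ) ≠ 0 := by exact_mod_cast Real.pi_ne_zero
  have h3 : ((iteratedDeriv (2 * m) normSinc 0 : ℝ) : ℂ)
      = (((-1) ^ m * (π ^ (2 * m) / (2 * (m : ℝ) + 1)) : ℝ) : ℂ) := by
    rw [h]
    push_cast
    field_simp
  exact_mod_cast h3

/-- At the nodes `y`, the unimodular number `i ^ n * exp (i π y)` is a sign. -/
theorem exists_sign (n : ℕ) {y : ℝ} (hy : Complex.exp (2 * π * Complex.I * y) = (-1) ^ n) :
    ∃ ε : ℝ, |ε| = 1 ∧ Complex.I ^ n * Complex.exp (Complex.I * π * y) = ε := by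
  have h : (Complex.I ^ n * Complex.exp (Complex.I * π * y))
      * (Complex.I ^ n * Complex.exp (Complex.I * π * y)) = 1 := by
    have e : Complex.exp (Complex.I * π * y) * Complex.exp (Complex.I * π * y) = (-1) ^ n := by
      rw [← hy, ← Complex.exp_add]; ring_nf
    calc _ = (Complex.I * Complex.I) ^ n *
        (Complex.exp (Complex.I * π * y) * Complex.exp (Complex.I * π * y)) := by ring
      _ = 1 := by rw [e, Complex.I_mul_I, ← mul_pow]; simp
  rcases mul_self_eq_one_iff.1 h with h | h
  · exact ⟨1, by simp, by simp [h]⟩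
  · exact ⟨-1, by simp, by simp [h]⟩

theorem sq_mul_iteratedDeriv_normSinc (N : ℕ) {y ε : ℝ}
    (hy : Complex.exp (2 * π * Complex.I * y) = (-1) ^ (N + 1))
    (hε : Complex.I ^ (N + 1) * Complex.exp (Complex.I * π * y) = ε) :
    y ^ 2 * iteratedDeriv (N + 1) normSinc y
      = (N + 1) * (π ^ N / π * ε + N * iteratedDeriv (N - 1) normSinc y) := by
  have h := sq_mul_bandIntegral_one N hy
  have hπ : (π : ℂ) ≠ 0 := by exact_mod_cast Real.pi_ne_zero
  rw [hε] at h
  have : ((y ^ 2 * iteratedDeriv (N + 1) normSinc y : ℝ) : ℂ)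
      = (((N + 1) * (π ^ N / π * ε + N * iteratedDeriv (N - 1) normSinc y) : ℝ) : ℂ) := by
    rw [Complex.ofReal_mul, iteratedDeriv_normSinc]
    push_cast
    rw [iteratedDeriv_normSinc]
    field_simp
    linear_combination h
  exact_mod_cast this

/-- The remainder left by the two integrations by parts never exceeds the boundary term `π ^ (N -
1)`. The form `π ^ N / π` avoids truncated subtraction at `N = 0`. -/
theorem nat_mul_abs_iteratedDeriv_normSinc_le (N : ℕ) (y : ℝ) :
    N * |iteratedDeriv (N - 1) normSinc y| ≤ π ^ N / π := by
  rcases N with _ | N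
  · simp [pi_pos.le]
  · have h := norm_bandIntegral_one_le N y
    have h2 : |iteratedDeriv N normSinc y| = (2 * π)⁻¹ * ‖bandIntegral (fun _ => 1) π N y‖ := by
      rw [← Real.norm_eq_abs, ← Complex.norm_real, iteratedDeriv_normSinc, norm_mul]
      simp [abs_of_pos pi_pos]
    rw [Nat.add_sub_cancel, h2]
    have hπ := pi_pos
    calc ((N + 1 : ℕ) : ℝ) * ((2 * π)⁻¹ * ‖bandIntegral (fun _ => 1) π N y‖)
        ≤ ((N + 1 : ℕ) : ℝ) * ((2 * π)⁻¹ * (2 * π ^ (N + 1) / (N + 1))) := by gcongr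
      _ = π ^ (N + 1) / π := by push_cast; field_simp

theorem abs_iteratedDeriv_normSinc_le (N : ℕ) {y : ℝ} (hy0 : y ≠ 0)
    (hy : Complex.exp (2 * π * Complex.I * y) = (-1) ^ (N + 1)) :
    |iteratedDeriv (N + 1) normSinc y| ≤ (N + 1) * (2 * (π ^ N / π)) * (1 / |y| ^ (2 : ℝ)) := by
  obtain ⟨ε, hε1, hε⟩ := exists_sign (N + 1) hy
  have h := sq_mul_iteratedDeriv_normSinc N hy hε
  have hb := nat_mul_abs_iteratedDeriv_normSinc_le N y
  have hy2 : 0 < |y| ^ 2 := by positivity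
  rw [Real.rpow_two, mul_one_div, le_div_iff₀ hy2, ← abs_pow, ← abs_mul, mul_comm, h, abs_mul,
    abs_of_pos (by positivity : (0 : ℝ) < N + 1)]
  refine mul_le_mul_of_nonneg_left ?_ (by positivity)
  refine (abs_add_le _ _).trans ?_
  have hπ : 0 < π ^ N / π := by positivity
  rw [abs_mul, abs_mul, hε1, abs_of_pos hπ, Nat.abs_cast]
  linarith

/-- Away from zero, `y ^ 2` times the derivative is a signed boundary term plus a remainder that
cannot outweigh it, so the derivative carries the sign `ε` or vanishes. At `y = 0` the node
condition forces an even order, where the value is explicit. -/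
theorem abs_iteratedDeriv_normSinc_eq (N : ℕ) {y : ℝ}
    (hy : Complex.exp (2 * π * Complex.I * y) = (-1) ^ (N + 1)) :
    ((|iteratedDeriv (N + 1) normSinc y| : ℝ) : ℂ) = iteratedDeriv (N + 1) normSinc y
      * (Complex.I ^ (N + 1) * Complex.exp (Complex.I * π * y)) := by
  obtain ⟨ε, hε1, hε⟩ := exists_sign (N + 1) hy
  have key : 0 ≤ iteratedDeriv (N + 1) normSinc y * ε := by
    have hεε : ε * ε = 1 := by rw [← abs_mul_abs_self, hε1, one_mul]
    rcases eq_or_ne y 0 with rfl | hy0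
    · have hev : Even (N + 1) := by
        simp only [Complex.ofReal_zero, mul_zero, Complex.exp_zero] at hy
        by_contra hodd
        rw [Nat.not_even_iff_odd] at hodd
        rw [hodd.neg_one_pow] at hy
        norm_num at hy
      obtain ⟨m, hm⟩ := hev.two_dvd
      rw [hm] at hε ⊢
      have : ε = (-1) ^ m := by
        rw [pow_mul, Complex.I_sq] at hε
        simp only [Complex.ofReal_zero, mul_zero, Complex.exp_zero, mul_one] at hε
        exact_mod_cast hε.symm
      rw [iteratedDeriv_even_normSinc_zero, this, mul_right_comm, ← mul_pow]
      have := pi_pos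
      simp only [mul_neg, mul_one, neg_neg, one_pow, one_mul]
      positivity
    · have h := sq_mul_iteratedDeriv_normSinc N hy hε
      have hb := nat_mul_abs_iteratedDeriv_normSinc_le N y
      have hy2 : 0 < y ^ 2 := by positivity
      refine nonneg_of_mul_nonneg_right (b := iteratedDeriv (N + 1) normSinc y * ε) ?_ hy2
      rw [← mul_assoc, h, mul_assoc]
      refine mul_nonneg (by positivity) ?_
      have h3 : -(N * |iteratedDeriv (N - 1) normSinc y|)
          ≤ N * (iteratedDeriv (N - 1) normSinc y * ε) := by
        rw [← mul_neg]
        refine mul_le_mul_of_nonneg_left ?_ (by positivity)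
        have := neg_abs_le (iteratedDeriv (N - 1) normSinc y * ε)
        rwa [abs_mul, hε1, mul_one] at this
      have h4 : (π ^ N / π * ε + N * iteratedDeriv (N - 1) normSinc y) * ε
          = π ^ N / π + N * (iteratedDeriv (N - 1) normSinc y * ε) := by
        linear_combination π ^ N / π * hεε
      rw [h4]
      linarith
  rw [hε, ← Complex.ofReal_mul, ← abs_of_nonneg key, abs_mul, hε1, mul_one]

/-- The coefficients `sinc⁽ⁿ⁾(δ - k)`. -/
noncomputable def sincCoeff (n : ℕ) (δ : ℝ) (k : ℤ) : ℝ := iteratedDeriv n normSinc (δ - k)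

theorem exp_node {n : ℕ} {δ : ℝ} (hδ : Complex.exp (2 * π * Complex.I * δ) = (-1) ^ n) (k : ℤ) :
    Complex.exp (2 * π * Complex.I * ((δ - k : ℝ) : ℂ)) = (-1) ^ n := by
  rw [← hδ, show 2 * π * Complex.I * ((δ - k : ℝ) : ℂ)
    = 2 * π * Complex.I * δ + ((-k : ℤ) : ℂ) * (2 * π * Complex.I) by push_cast; ring,
    Complex.exp_add, Complex.exp_int_mul_two_pi_mul_I, mul_one]

theorem summable_abs_sincCoeff {n : ℕ} (hn : n ≠ 0) {δ : ℝ}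
    (hδ : Complex.exp (2 * π * Complex.I * δ) = (-1) ^ n) :
    Summable fun k => |sincCoeff n δ k| := by
  obtain ⟨N, rfl⟩ := Nat.exists_eq_succ_of_ne_zero hn
  have h1 := ((Real.summable_one_div_int_add_rpow (-δ) 2).2 (by norm_num)).mul_left
    ((N + 1) * (2 * (π ^ N / π)))
  refine h1.of_norm_bounded_eventually ?_
  have hfin : {k : ℤ | δ - k = 0}.Finite := by
    refine Set.Subsingleton.finite fun a ha b hb => ?_
    have : (a : ℝ) = b := by
      simp only [mem_ofPred_eq] at ha hb
      linarith
    exact_mod_cast this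
  filter_upwards [hfin.compl_mem_cofinite] with k hk
  have := abs_iteratedDeriv_normSinc_le N hk (exp_node hδ k)
  rw [abs_sub_comm] at this
  simpa [sincCoeff, sub_eq_add_neg] using this


/-! ### Fourier series of the differentiation symbol. -/

/-- The Fourier expansion of `(i t) ^ n` on `[-π, π]` along the shifted frequencies `k - δ`. -/
theorem hasSum_sincCoeff_mul_exp {n : ℕ} (hn : n ≠ 0) {δ : ℝ}
    (hδ : Complex.exp (2 * π * Complex.I * δ) = (-1) ^ n) {t : ℝ} (ht : t ∈ Icc (-π) π) :
    HasSum (fun k : ℤ => (sincCoeff n δ k : ℂ) * Complex.exp (Complex.I * t * ((k - δ : ℝ) : ℂ)))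
      ((Complex.I * t) ^ n) := by
  have hT : Fact (0 < 2 * π) := ⟨by positivity⟩
  have hπ : (π : ℂ) ≠ 0 := by exact_mod_cast Real.pi_ne_zero
  set g : ℝ → ℂ := fun t => (Complex.I * t) ^ n * Complex.exp (Complex.I * δ * t) with hg
  -- The twist `exp (iδt)` contributes `(-1)^n` over a period and compensates the parity of `t ^ n`.
  have hends : g (-π) = g (-π + 2 * π) := by
    simp only [hg]
    have e : Complex.exp (Complex.I * δ * ((-π + 2 * π : ℝ) : ℂ))
        = (-1) ^ n * Complex.exp (Complex.I * δ * ((-π : ℝ) : ℂ)) := by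
      rw [← hδ, ← Complex.exp_add]
      congr 1
      push_cast
      ring
    rw [e, show ((-π + 2 * π : ℝ) : ℂ) = -((-π : ℝ) : ℂ) by push_cast; ring, mul_neg, neg_pow]
    have : ((-1 : ℂ) ^ n) * (-1) ^ n = 1 := by rw [← mul_pow]; simp
    linear_combination (-((Complex.I * ((-π : ℝ) : ℂ)) ^ n *
      Complex.exp (Complex.I * δ * ((-π : ℝ) : ℂ)))) * this
  set G : C(AddCircle (2 * π), ℂ) := ⟨AddCircle.liftIco (2 * π) (-π) g,
    AddCircle.liftIco_continuous hends (by fun_prop : Continuous g).continuousOn⟩ with hG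
  have hcoeff : ∀ k, fourierCoeff G k = sincCoeff n δ k := by
    intro k
    change fourierCoeff (AddCircle.liftIco (2 * π) (-π) g) k = _
    rw [fourierCoeff_liftIco_eq, fourierCoeffOn_eq_integral, sincCoeff, iteratedDeriv_normSinc]
    rw [Complex.real_smul]
    congr 1
    · push_cast; ring
    · unfold bandIntegral
      rw [show -π + 2 * π = π by ring]
      congr 1 with v
      rw [fourier_coe_apply, smul_eq_mul, hg, one_mul, mul_left_comm, ← Complex.exp_add]
      congr 2
      push_cast
      field_simp
      ring
  have hsum : Summable (fourierCoeff G) := by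
    simp_rw [funext hcoeff]
    exact .of_norm (by simpa using summable_abs_sincCoeff hn hδ)
  have h := has_pointwise_sum_fourier_series_of_summable hsum (t : AddCircle (2 * π))
  have hGt : G t = g t := by
    change AddCircle.liftIco (2 * π) (-π) g t = _
    rcases ht.2.eq_or_lt with rfl | hlt
    · have e : ((π : ℝ) : AddCircle (2 * π)) = ((-π : ℝ) : AddCircle (2 * π)) := by
        rw [← AddCircle.coe_add_period (2 * π) (-π)]
        congr 1
        ring
      rw [e, AddCircle.liftIco_coe_apply ⟨le_rfl, by linarith [hT.out]⟩, hends]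
      congr 1
      ring
    · exact AddCircle.liftIco_coe_apply ⟨ht.1, by linarith⟩
  rw [hGt] at h
  have h2 := h.mul_right (Complex.exp (-(Complex.I * δ * t)))
  have hgt : g t * Complex.exp (-(Complex.I * δ * t)) = (Complex.I * t) ^ n := by
    rw [hg, mul_assoc, ← Complex.exp_add, add_neg_cancel, Complex.exp_zero, mul_one]
  rw [hgt] at h2
  convert! h2 using 2 with k
  rw [hcoeff, fourier_coe_apply, smul_eq_mul, mul_assoc (sincCoeff n δ k : ℂ), ← Complex.exp_add]
  congr 2
  push_cast
  field_simp
  ring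

/-- At the endpoint `t = -π` the exponentials are, up to the factor `i^n`, exactly the signs of the
coefficients, so the expansion becomes a series of absolute values. -/
theorem tsum_abs_sincCoeff {n : ℕ} (hn : n ≠ 0) {δ : ℝ}
    (hδ : Complex.exp (2 * π * Complex.I * δ) = (-1) ^ n) :
    ∑' k, |sincCoeff n δ k| = π ^ n := by
  have h := (hasSum_sincCoeff_mul_exp hn hδ (t := -π) ⟨le_rfl, by linarith [pi_pos]⟩).mul_left
    (Complex.I ^ n)
  obtain ⟨N, rfl⟩ := Nat.exists_eq_succ_of_ne_zero hn
  have e : ∀ k : ℤ, Complex.I ^ (N + 1) * ((sincCoeff (N + 1) δ k : ℂ) *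
      Complex.exp (Complex.I * ((-π : ℝ) : ℂ) * ((k - δ : ℝ) : ℂ)))
      = ((|sincCoeff (N + 1) δ k| : ℝ) : ℂ) := by
    intro k
    rw [sincCoeff, abs_iteratedDeriv_normSinc_eq N (exp_node hδ k), mul_left_comm]
    congr 3
    push_cast
    ring
  have e2 : Complex.I ^ (N + 1) * (Complex.I * ((-π : ℝ) : ℂ)) ^ (N + 1)
      = ((π ^ (N + 1) : ℝ) : ℂ) := by
    rw [← mul_pow, ← mul_assoc, Complex.I_mul_I]
    push_cast
    ring
  simp only [Nat.succ_eq_add_one] at h ⊢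
  rw [funext e, e2, Complex.hasSum_ofReal] at h
  exact h.tsum_eq

/-! ### Approximate identities from Schwartz dilates. -/

theorem tendsto_integral_mul_dilate_of_bounded (K : 𝓢(ℝ, ℂ)) {h : ℝ → ℂ}
    (hm : Measurable h) {M : ℝ} (hM : ∀ w, ‖h w‖ ≤ M) (h0 : ContinuousAt h 0) :
    Tendsto (fun c : ℝ => ∫ w, h w * (c * K (c * w))) atTop (𝓝 (h 0 * ∫ w, K w)) := by
  have h1 : Tendsto (fun c : ℝ => ∫ u, h (c⁻¹ * u) * K u) atTop (𝓝 (∫ u, h 0 * K u)) := by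
    refine tendsto_integral_filter_of_dominated_convergence (fun u => M * ‖K u‖) ?_ ?_ ?_ ?_
    · exact .of_forall fun c => ((hm.comp (measurable_const_mul _)).mul
        K.continuous.measurable).aestronglyMeasurable
    · refine .of_forall fun c => .of_forall fun u => ?_
      rw [norm_mul]
      gcongr
      exact hM _
    · exact K.integrable.norm.const_mul M
    · refine .of_forall fun u => Tendsto.mul_const _ ?_
      have h2 : Tendsto (fun c : ℝ => c⁻¹ * u) atTop (𝓝 0) := by
        simpa using tendsto_inv_atTop_zero.mul_const u
      exact h0.tendsto.comp h2
  rw [integral_const_mul] at h1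
  refine h1.congr' ?_
  filter_upwards [eventually_gt_atTop 0] with c hc
  have h3 := Measure.integral_comp_mul_left (fun u => h (c⁻¹ * u) * K u) c
  rw [abs_of_pos (inv_pos.2 hc)] at h3
  have h4 : ∫ w, h w * (c * K (c * w)) = c * ∫ w, h (c⁻¹ * (c * w)) * K (c * w) := by
    rw [← integral_const_mul]
    congr 1 with w
    rw [inv_mul_cancel_left₀ hc.ne']
    ring
  rw [h4, h3, Complex.real_smul]
  have : (c : ℂ) ≠ 0 := by exact_mod_cast hc.ne'
  push_cast
  rw [mul_inv_cancel_left₀ this]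

theorem exists_norm_mul_dilate_le (K : 𝓢(ℝ, ℂ)) (k : ℕ) :
    ∃ C : ℝ, 0 ≤ C ∧ ∀ c w : ℝ, 1 ≤ c → 1 ≤ |w| →
      ‖(c : ℂ) * K (c * w)‖ ≤ C * c⁻¹ * (1 + ‖w‖) ^ (-(k : ℝ)) := by
  -- The decay order `k + 2` leaves, after the weight is paid for, a factor `c⁻²`: one power absorbs
  -- the prefactor `c`, the other makes the bound tend to zero.
  obtain ⟨C, hC0, hC⟩ := K.decay (k + 2) 0
  refine ⟨C * 2 ^ k, by positivity, fun c w hc hw => ?_⟩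
  have hc0 : 0 < c := by linarith
  have h := hC (c * w)
  simp only [norm_iteratedFDeriv_zero, norm_mul, Real.norm_eq_abs, abs_of_pos hc0] at h
  rw [norm_mul, Complex.norm_real, Real.norm_eq_abs, abs_of_pos hc0, Real.norm_eq_abs,
    Real.rpow_neg (by positivity), Real.rpow_natCast]
  have h1 : (1 + |w|) ^ k ≤ 2 ^ k * |w| ^ k := by
    rw [← mul_pow]
    gcongr
    linarith
  rw [← div_eq_mul_inv, le_div_iff₀ (by positivity), ← div_eq_mul_inv, le_div_iff₀ hc0]
  have h2 : c * (1 + |w|) ^ k * c ≤ 2 ^ k * (c * |w|) ^ (k + 2) := by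
    have h3 : 1 ≤ c ^ k * |w| ^ 2 := one_le_mul_of_one_le_of_one_le (one_le_pow₀ hc) (one_le_pow₀ hw)
    calc c * (1 + |w|) ^ k * c ≤ c * (2 ^ k * |w| ^ k) * c := by gcongr
      _ = 2 ^ k * c ^ 2 * |w| ^ k * 1 := by ring
      _ ≤ 2 ^ k * c ^ 2 * |w| ^ k * (c ^ k * |w| ^ 2) := by gcongr
      _ = 2 ^ k * (c * |w|) ^ (k + 2) := by ring
  calc c * ‖K (c * w)‖ * (1 + |w|) ^ k * c = (c * (1 + |w|) ^ k * c) * ‖K (c * w)‖ := by ring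
    _ ≤ (2 ^ k * (c * |w|) ^ (k + 2)) * ‖K (c * w)‖ := by gcongr
    _ = 2 ^ k * ((c * |w|) ^ (k + 2) * ‖K (c * w)‖) := by ring
    _ ≤ 2 ^ k * C := by gcongr
    _ = C * 2 ^ k := by ring

/-- Dilates of a Schwartz function are an approximate identity at a continuous function with
polynomially weighted integrability. -/
theorem tendsto_integral_mul_dilate (K : 𝓢(ℝ, ℂ)) {h : ℝ → ℂ} (hc : Continuous h) (k : ℕ)
    (hk : Integrable fun w => ‖h w‖ * (1 + ‖w‖) ^ (-(k : ℝ))) :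
    Tendsto (fun c : ℝ => ∫ w, h w * (c * K (c * w))) atTop (𝓝 (h 0 * ∫ w, K w)) := by
  obtain ⟨C, hC0, hC⟩ := exists_norm_mul_dilate_le K k
  -- Near zero `h` is bounded and the bounded case applies; outside `S` the kernel is `O(c⁻¹)`
  -- against the integrable weight.
  set S : Set ℝ := Icc (-1) 1
  have hSm : MeasurableSet S := measurableSet_Icc
  obtain ⟨M, hM⟩ := (isCompact_Icc (a := (-1 : ℝ)) (b := 1)).exists_bound_of_continuousOn
    hc.continuousOn
  have hM0 : 0 ≤ M := (norm_nonneg _).trans (hM 0 (by simp))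
  have hMS : ∀ w, ‖S.indicator h w‖ ≤ M := fun w => by
    by_cases hw : w ∈ S
    · simpa [hw] using hM w hw
    · simpa [hw] using hM0
  have hSnhds : S ∈ 𝓝 (0 : ℝ) := Icc_mem_nhds (by norm_num) (by norm_num)
  have hcont : ContinuousAt (S.indicator h) 0 := by
    refine hc.continuousAt.congr ?_
    filter_upwards [hSnhds] with w hw using (indicator_of_mem hw h).symm
  have hA := tendsto_integral_mul_dilate_of_bounded K (hc.measurable.indicator hSm) hMS hcont
  rw [indicator_of_mem (by simp [S] : (0 : ℝ) ∈ S)] at hA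
  have hbound : ∀ c : ℝ, 1 ≤ c → ∀ w, ‖Sᶜ.indicator h w * (c * K (c * w))‖
      ≤ C * c⁻¹ * (‖h w‖ * (1 + ‖w‖) ^ (-(k : ℝ))) := by
    intro c hc1 w
    by_cases hw : w ∈ S
    · rw [indicator_of_notMem (by simpa using hw), zero_mul, norm_zero]
      positivity
    · rw [indicator_of_mem (by simpa using hw), norm_mul]
      have h1 : 1 ≤ |w| := by
        by_contra hlt
        exact hw (abs_le.1 (not_le.1 hlt).le)
      calc ‖h w‖ * ‖(c : ℂ) * K (c * w)‖ ≤ ‖h w‖ * (C * c⁻¹ * (1 + ‖w‖) ^ (-(k : ℝ))) := by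
            gcongr
            exact hC c w hc1 h1
        _ = _ := by ring
  have hB : Tendsto (fun c : ℝ => ∫ w, Sᶜ.indicator h w * (c * K (c * w))) atTop (𝓝 0) := by
    have hlim : Tendsto (fun c : ℝ => C * c⁻¹ * ∫ w, ‖h w‖ * (1 + ‖w‖) ^ (-(k : ℝ))) atTop
        (𝓝 0) := by
      simpa using (tendsto_inv_atTop_zero.const_mul C).mul_const
        (∫ w, ‖h w‖ * (1 + ‖w‖) ^ (-(k : ℝ)))
    refine squeeze_zero_norm' ?_ hlim
    filter_upwards [eventually_ge_atTop 1] with c hc1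
    rw [← integral_const_mul]
    exact norm_integral_le_of_norm_le (hk.const_mul _) (.of_forall (hbound c hc1))
  rw [← add_zero (h 0 * ∫ w, K w)]
  refine (hA.add hB).congr' ?_
  filter_upwards [eventually_ge_atTop 1] with c hc1
  have hKm : Measurable fun w : ℝ => (c : ℂ) * K (c * w) :=
    (K.continuous.measurable.comp (measurable_const_mul c)).const_mul _
  have hKi : Integrable fun w : ℝ => (c : ℂ) * K (c * w) :=
    (K.integrable.comp_mul_left' (by linarith : c ≠ 0)).const_mul _
  rw [← integral_add]
  · congr 1 with w
    rw [← add_mul, indicator_self_add_compl_apply]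
  · exact hKi.bdd_mul (hc.measurable.indicator hSm).aestronglyMeasurable (.of_forall hMS)
  · exact (hk.const_mul (C * c⁻¹)).mono' ((hc.measurable.indicator hSm.compl).mul
      hKm).aestronglyMeasurable (.of_forall (hbound c hc1))

theorem MeasureTheory.MemLp.exists_integrable_weighted {p : ℝ≥0∞} (hp : 1 ≤ p) {f : ℝ → ℂ}
    (hf : MemLp f p volume) :
    ∃ k : ℕ, Integrable fun w => ‖f w‖ * (1 + ‖w‖) ^ (-(k : ℝ)) := by
  have := ENNReal.HolderConjugate.conjExponent hp
  obtain ⟨k, hk⟩ := Measure.HasTemperateGrowth.exists_eLpNorm_lt_top (μ := (volume : Measure ℝ))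
    p.conjExponent inferInstance
  refine ⟨k, hf.norm.integrable_mul (q := p.conjExponent) ⟨?_, hk⟩⟩
  exact (Continuous.rpow_const (by fun_prop) fun x => .inl (by positivity)).aestronglyMeasurable

/-! ### Reproducing kernels for the Bernstein space. -/

section

open scoped FourierTransform

/-- The inverse Fourier transform `(2π)⁻¹ ∫ χ(v) e^{i v y} dv` as a Schwartz function. -/
noncomputable def synthesis (χ : 𝓢(ℝ, ℂ)) : 𝓢(ℝ, ℂ) :=
  ((2 * π : ℝ) : ℂ)⁻¹ • SchwartzMap.compCLMOfContinuousLinearEquiv ℂ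
    (ContinuousLinearEquiv.unitsEquivAut ℝ (Units.mk0 (-(2 * π)⁻¹ : ℝ) (by simp [pi_ne_zero])))
    (𝓕 χ)

theorem synthesis_apply_eq_fourier (χ : 𝓢(ℝ, ℂ)) (y : ℝ) :
    synthesis χ y = ((2 * π : ℝ) : ℂ)⁻¹ * (𝓕 (χ : ℝ → ℂ)) (y * (-(2 * π)⁻¹)) := by
  simp [synthesis, SchwartzMap.fourier_coe]

theorem synthesis_apply (χ : 𝓢(ℝ, ℂ)) (y : ℝ) :
    synthesis χ y = ((2 * π : ℝ) : ℂ)⁻¹ * ∫ v, χ v * Complex.exp (Complex.I * v * y) := by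
  rw [synthesis_apply_eq_fourier, Real.fourier_real_eq_integral_exp_smul]
  have hπ : (π : ℂ) ≠ 0 := by exact_mod_cast Real.pi_ne_zero
  congr 2 with v
  rw [smul_eq_mul, mul_comm]
  congr 2
  push_cast
  field_simp

/-- This is Fourier inversion at the origin; it normalizes the approximate identity. -/
theorem integral_synthesis (χ : 𝓢(ℝ, ℂ)) : ∫ y, synthesis χ y = χ 0 := by
  simp_rw [synthesis_apply_eq_fourier]
  rw [integral_const_mul, Measure.integral_comp_mul_right (𝓕 (χ : ℝ → ℂ))]
  have h := χ.integrable.fourierInv_fourier_eq (v := 0)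
    (by rw [← SchwartzMap.fourier_coe]; exact SchwartzMap.integrable _) χ.continuous.continuousAt
  rw [Real.fourierInv_eq'] at h
  simp only [inner_zero_right, mul_zero, Complex.ofReal_zero, zero_mul, Complex.exp_zero,
    one_smul] at h
  rw [h, inv_neg, inv_inv, abs_neg, abs_of_pos (by positivity), Complex.real_smul,
    inv_mul_cancel_left₀]
  exact_mod_cast (by positivity : (2 * π : ℝ) ≠ 0)

theorem angularFourier_eq_synthesis (χ : 𝓢(ℝ, ℂ)) (ξ : ℝ) :
    angularFourier χ ξ = (√(2 * π) : ℂ) * synthesis χ (-ξ) := by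
  rw [synthesis_apply, angularFourier, ← mul_assoc]
  congr 1
  · rw [← Complex.ofReal_inv, ← Complex.ofReal_mul]
    congr 1
    have : 0 < √(2 * π) := by positivity
    have h2 : √(2 * π) * √(2 * π) = 2 * π := Real.mul_self_sqrt (by positivity)
    nth_rw 3 [← h2]
    field_simp
  · congr 1 with v
    congr 2
    push_cast
    ring

theorem synthesis_dilate {χ χ' : 𝓢(ℝ, ℂ)} {c : ℝ} (hc : 0 < c) (h : ∀ v, χ' v = χ (c⁻¹ * v))
    (y : ℝ) : synthesis χ' y = c * synthesis χ (c * y) := by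
  have h3 := Measure.integral_comp_mul_left
    (fun v => χ v * Complex.exp (Complex.I * v * ((c * y : ℝ) : ℂ))) c⁻¹
  rw [inv_inv, abs_of_pos hc, Complex.real_smul] at h3
  rw [synthesis_apply, synthesis_apply, mul_left_comm, ← h3]
  congr 2 with v
  rw [h]
  congr 2
  have : (c : ℂ) ≠ 0 := by exact_mod_cast hc.ne'
  push_cast
  field_simp

/-- A distribution with spectrum in `[-σ, σ]` is orthogonal to kernels with spectrum
away from `[-σ, σ]`. -/
theorem MemBernstein.integral_mul_synthesis_eq_zero {σ : ℝ} {p : ℝ≥0∞} {f : ℝ → ℂ}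
    (hf : MemBernstein σ p f) {χ : 𝓢(ℝ, ℂ)} (hχ : HasCompactSupport χ) {r : ℝ} (hr : σ < r)
    (h0 : ∀ v, |v| < r → χ v = 0) (x : ℝ) : ∫ y, f y * synthesis χ (x - y) = 0 := by
  -- Modulating `χ` by `exp (ixv)` translates its transform by `x` without enlarging the support.
  have hs : ContDiff ℝ ∞ fun v : ℝ => χ v * Complex.exp (Complex.I * x * v) := by
    have := Complex.ofRealCLM.contDiff (n := ∞)
    exact (χ.smooth ⊤).mul (contDiff_const.mul this).cexp
  set ψ : 𝓢(ℝ, ℂ) :=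
    (hχ.mul_right (f' := fun v : ℝ => Complex.exp (Complex.I * x * v))).toSchwartzMap hs
  have hψ : ∀ v, ψ v = χ v * Complex.exp (Complex.I * x * v) := fun v => rfl
  have hsupp : tsupport ψ ⊆ (Icc (-σ) σ)ᶜ := by
    have h1 : tsupport ψ ⊆ {v : ℝ | r ≤ |v|} := by
      refine closure_minimal (fun v hv => ?_) (isClosed_le continuous_const continuous_abs)
      by_contra hlt
      exact hv (by rw [hψ, h0 v (not_le.1 hlt), zero_mul])
    intro v hv hv2
    have := h1 hv
    exact (hr.trans_le this).not_ge (abs_le.2 hv2)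
  have h := hf.fourier_support ψ hsupp
  have hsyn : ∀ y, angularFourier ψ y = (√(2 * π) : ℂ) * synthesis χ (x - y) := by
    intro y
    rw [angularFourier_eq_synthesis, synthesis_apply, synthesis_apply]
    congr 3 with v
    rw [hψ, mul_assoc, ← Complex.exp_add]
    congr 2
    push_cast
    ring
  have e : (fun y => f y * angularFourier ψ y)
      = fun y => (√(2 * π) : ℂ) * (f y * synthesis χ (x - y)) := by
    funext y
    rw [hsyn]
    ring
  rw [distFourier, e, integral_const_mul] at h
  refine (mul_eq_zero.1 h).resolve_left ?_
  exact_mod_cast (by positivity : √(2 * π) ≠ 0)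

theorem MeasureTheory.MemLp.integrable_mul_schwartz {p : ℝ≥0∞} (hp : 1 ≤ p) {f : ℝ → ℂ}
    (hf : MemLp f p volume) (K : 𝓢(ℝ, ℂ)) (x : ℝ) : Integrable fun y => f y * K (x - y) := by
  have := ENNReal.HolderConjugate.conjExponent hp
  exact hf.integrable_mul (q := p.conjExponent)
    ((K.memLp p.conjExponent).comp_measurePreserving (Measure.measurePreserving_sub_left volume x))

theorem MeasureTheory.MemLp.enorm_integral_mul_schwartz_le {p : ℝ≥0∞} (hp : 1 ≤ p)
    {f : ℝ → ℂ} (hf : MemLp f p volume) (K : 𝓢(ℝ, ℂ)) (x : ℝ) :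
    ‖∫ y, f y * K (x - y)‖ₑ ≤ eLpNorm f p volume * eLpNorm K p.conjExponent volume := by
  have hq : p.HolderConjugate p.conjExponent := ENNReal.HolderConjugate.conjExponent hp
  have hmp := Measure.measurePreserving_sub_left (volume : Measure ℝ) x
  have hK := eLpNorm_comp_measurePreserving (p := p.conjExponent)
    K.continuous.aestronglyMeasurable hmp
  have hm : AEStronglyMeasurable (K ∘ fun y => x - y) volume :=
    K.continuous.aestronglyMeasurable.comp_measurePreserving hmp
  rw [← hK]
  have h := eLpNorm_smul_le_mul_eLpNorm (p := p) (q := p.conjExponent) (r := 1) hm hf.1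
  rw [eLpNorm_one_eq_lintegral_enorm] at h
  exact (enorm_integral_le_lintegral_enorm _).trans h

theorem MeasureTheory.MemLp.exists_bound_integral_mul_schwartz {p : ℝ≥0∞} (hp : 1 ≤ p)
    {f : ℝ → ℂ} (hf : MemLp f p volume) (K : 𝓢(ℝ, ℂ)) :
    ∃ M : ℝ, ∀ x, ‖∫ y, f y * K (x - y)‖ ≤ M := by
  have hKq : eLpNorm K p.conjExponent volume < ⊤ := (K.memLp p.conjExponent volume).2
  have hfin : eLpNorm f p volume * eLpNorm K p.conjExponent volume ≠ ⊤ :=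
    ENNReal.mul_ne_top hf.2.ne hKq.ne
  refine ⟨(eLpNorm f p volume * eLpNorm K p.conjExponent volume).toReal, fun x => ?_⟩
  rw [← toReal_enorm]
  exact ENNReal.toReal_mono hfin (hf.enorm_integral_mul_schwartz_le hp K x)

/-- Functions in the Bernstein space are reproduced by a Schwartz kernel whose spectrum lies in a
slightly larger band. -/
theorem MemBernstein.exists_reproducing_kernel {σ s : ℝ} (hσ : 0 < σ) (hs : σ < s) :
    ∃ (χ : ℝ → ℂ) (K : 𝓢(ℝ, ℂ)), Continuous χ ∧
      (∀ y, K y = ((2 * π : ℝ) : ℂ)⁻¹ * bandIntegral χ s 0 y) ∧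
      ∀ (p : ℝ≥0∞) (f : ℝ → ℂ), 1 ≤ p → MemBernstein σ p f → ∀ x, f x = ∫ y, f y * K (x - y) := by
  -- The cutoff equals `1` up to `r > σ`, so differences of its dilates vanish on a neighbourhood of
  -- `[-σ, σ]`.
  obtain ⟨r, hr1, hr2⟩ := exists_between hs
  let b : ContDiffBump (0 : ℝ) := ⟨r, s, hσ.trans hr1, hr2⟩
  have hsm : ContDiff ℝ ∞ fun v : ℝ => ((b v : ℝ) : ℂ) := Complex.ofRealCLM.contDiff.comp b.contDiff
  have hcs : HasCompactSupport fun v : ℝ => ((b v : ℝ) : ℂ) :=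
    b.hasCompactSupport.comp_left Complex.ofReal_zero
  have hb1 : ∀ v, |v| < r → b v = 1 := fun v hv =>
    b.one_of_mem_closedBall (by simpa [b] using hv.le)
  have hb0 : ∀ v, s ≤ |v| → b v = 0 := fun v hv => b.zero_of_le_dist (by simpa [b] using hv)
  set χ : 𝓢(ℝ, ℂ) := hcs.toSchwartzMap hsm
  have hχ : ∀ v, χ v = b v := fun _ => rfl
  refine ⟨fun v => b v, synthesis χ, hsm.continuous, fun y => ?_, fun p f hp hf x => ?_⟩
  · rw [synthesis_apply, bandIntegral]
    congr 1
    simp only [pow_zero, mul_one, hχ]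
    rw [intervalIntegral.integral_of_le (by linarith), ← integral_Icc_eq_integral_Ioc,
      setIntegral_eq_integral_of_forall_compl_eq_zero]
    intro v hv
    rw [hb0 v, Complex.ofReal_zero, zero_mul]
    by_contra hlt
    exact hv (abs_le.1 (not_le.1 hlt).le)
  -- For `c ≥ 1`, `χ (v / c)` and `χ v` agree for `|v| < r`, so convolving `f` with either kernel
  -- gives the same result. As `c → ∞` the dilated kernels form an approximate identity of mass `χ 0
  -- = 1`, and the constant value must be `f x`.
  · have hdil : ∀ c : ℝ, 1 ≤ c → ∫ y, f y * (c * synthesis χ (c * (x - y)))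
        = ∫ y, f y * synthesis χ (x - y) := by
      intro c hc
      have hc0 : 0 < c := by linarith
      have hcs' : HasCompactSupport fun v : ℝ => ((b (c⁻¹ * v) : ℝ) : ℂ) := by
        have := hcs.comp_homeomorph (Homeomorph.mulLeft₀ c⁻¹ (inv_ne_zero hc0.ne'))
        exact this
      have hsm' : ContDiff ℝ ∞ fun v : ℝ => ((b (c⁻¹ * v) : ℝ) : ℂ) :=
        hsm.comp (contDiff_const.mul contDiff_id)
      set χ' : 𝓢(ℝ, ℂ) := hcs'.toSchwartzMap hsm'
      have hχ' : ∀ v, χ' v = b (c⁻¹ * v) := fun _ => rfl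
      have hz := hf.integral_mul_synthesis_eq_zero (χ := χ' - χ) (hcs'.sub hcs) hr1 (x := x) <| by
        intro v hv
        rw [sub_apply, hχ, hχ', hb1 v hv, hb1, sub_self]
        rw [abs_mul, abs_of_pos (inv_pos.2 hc0)]
        exact (mul_le_of_le_one_left (abs_nonneg v) (inv_le_one_of_one_le₀ hc)).trans_lt hv
      have hsub : ∀ y, synthesis (χ' - χ) y = synthesis χ' y - synthesis χ y := by
        intro y
        simp only [synthesis_apply, ← mul_sub, sub_apply, sub_mul]
        rw [integral_sub]
        · exact (χ'.integrable.mul_bdd (c := 1) (by fun_prop : Continuous fun v : ℝ =>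
            Complex.exp (Complex.I * v * y)).aestronglyMeasurable (.of_forall fun v => (norm_exp_I_mul_mul v y).le))
        · exact (χ.integrable.mul_bdd (c := 1) (by fun_prop : Continuous fun v : ℝ =>
            Complex.exp (Complex.I * v * y)).aestronglyMeasurable (.of_forall fun v => (norm_exp_I_mul_mul v y).le))
      simp_rw [hsub, mul_sub] at hz
      rw [integral_sub (hf.memLp.integrable_mul_schwartz hp _ x)
        (hf.memLp.integrable_mul_schwartz hp _ x), sub_eq_zero] at hz
      rw [← hz]
      congr 1 with y
      rw [synthesis_dilate (χ := χ) (χ' := χ') hc0 (fun v => by rw [hχ', hχ])]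
    have hmp := Measure.measurePreserving_sub_left (volume : Measure ℝ) x
    obtain ⟨k, hk⟩ := (hf.memLp.comp_measurePreserving hmp).exists_integrable_weighted hp
    have hlim := tendsto_integral_mul_dilate (synthesis χ) (h := f ∘ fun y => x - y)
      (hf.contDiff.continuous.comp (by fun_prop)) k hk
    rw [integral_synthesis, hχ, hb1 0 (by simpa using hσ.trans hr1), Complex.ofReal_one, mul_one,
      Function.comp_apply, sub_zero] at hlim
    refine tendsto_nhds_unique hlim (tendsto_const_nhds.congr' ?_)
    filter_upwards [eventually_ge_atTop 1] with c hc
    rw [← hdil c hc, ← integral_sub_left_eq_self _ volume x]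
    simp

end

/-! ### The differentiation formula. -/

/-- The symbol expansion at `t = πv / a`, which stays in `[-π, π]` on the band, is integrated
termwise against `χ v * exp (ivy)`. -/
theorem hasSum_sincCoeff_mul_bandIntegral {χ : ℝ → ℂ} (hχ : Continuous χ) {a : ℝ} (ha : 0 < a)
    {n : ℕ} (hn : n ≠ 0) {δ : ℝ} (hδ : Complex.exp (2 * π * Complex.I * δ) = (-1) ^ n) (y : ℝ) :
    HasSum (fun k : ℤ => (sincCoeff n δ k : ℂ) * bandIntegral χ a 0 (y + π / a * (k - δ)))
      (((π / a : ℝ) : ℂ) ^ n * bandIntegral χ a n y) := by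
  have hsum := summable_abs_sincCoeff hn hδ
  have h := intervalIntegral.hasSum_integral_of_dominated_convergence (μ := volume)
    (a := -a) (b := a)
    (F := fun (k : ℤ) v => χ v * ((sincCoeff n δ k : ℂ) *
      Complex.exp (Complex.I * ((π / a * v : ℝ) : ℂ) * ((k - δ : ℝ) : ℂ))) *
      Complex.exp (Complex.I * v * y))
    (f := fun v => χ v * (Complex.I * ((π / a * v : ℝ) : ℂ)) ^ n * Complex.exp (Complex.I * v * y))
    (fun k v => ‖χ v‖ * |sincCoeff n δ k|)
    (fun k => (by fun_prop : Continuous _).aestronglyMeasurable)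
    (fun k => .of_forall fun v _ => by
      simp only [norm_mul, norm_exp_I_mul_mul, mul_one, Complex.norm_real, Real.norm_eq_abs]
      rfl)
    (.of_forall fun v _ => hsum.mul_left _)
    (by
      simp_rw [tsum_mul_left]
      exact (by fun_prop : Continuous _).intervalIntegrable _ _)
    (.of_forall fun v hv => by
      refine ((hasSum_sincCoeff_mul_exp hn hδ ?_).mul_left _).mul_right _
      rw [uIoc_of_le (by linarith)] at hv
      have hπ := pi_pos
      have e : π / a * a = π := div_mul_cancel₀ _ ha.ne'
      constructor
      · have := mul_le_mul_of_nonneg_left hv.1.le (by positivity : 0 ≤ π / a)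
        linarith
      · have := mul_le_mul_of_nonneg_left hv.2 (by positivity : 0 ≤ π / a)
        linarith)
  have e1 : ∀ k : ℤ, (sincCoeff n δ k : ℂ) * bandIntegral χ a 0 (y + π / a * (k - δ))
      = ∫ v in (-a)..a, χ v * ((sincCoeff n δ k : ℂ) *
      Complex.exp (Complex.I * ((π / a * v : ℝ) : ℂ) * ((k - δ : ℝ) : ℂ))) *
      Complex.exp (Complex.I * v * y) := by
    intro k
    rw [bandIntegral, ← intervalIntegral.integral_const_mul]
    congr 1 with v
    rw [pow_zero, mul_one, mul_assoc (χ v), mul_assoc (sincCoeff n δ k : ℂ), ← Complex.exp_add,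
      mul_left_comm]
    congr 3
    push_cast
    ring
  have e2 : ((π / a : ℝ) : ℂ) ^ n * bandIntegral χ a n y = ∫ v in (-a)..a,
      χ v * (Complex.I * ((π / a * v : ℝ) : ℂ)) ^ n * Complex.exp (Complex.I * v * y) := by
    rw [bandIntegral, ← intervalIntegral.integral_const_mul]
    congr 1 with v
    rw [Complex.ofReal_mul, mul_left_comm Complex.I, mul_pow (((π / a : ℝ) : ℂ))]
    ring
  rw [e2, funext e1]
  exact h

/-- Supplies an integrable majorant, uniform over unit translations, for differentiating a
convolution under the integral sign. -/
theorem exists_norm_schwartz_near_le (K : 𝓢(ℝ, ℂ)) :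
    ∃ C : ℝ, ∀ u t : ℝ, |t| ≤ 1 → ‖K (u + t)‖ ≤ C * (1 + u ^ 2)⁻¹ := by
  obtain ⟨C0, hC0, h0⟩ := K.decay 0 0
  obtain ⟨C2, hC2, h2⟩ := K.decay 2 0
  refine ⟨3 * (C0 + C2), fun u t ht => ?_⟩
  have h0 := h0 (u + t)
  have h2 := h2 (u + t)
  simp only [norm_iteratedFDeriv_zero, pow_zero, one_mul, Real.norm_eq_abs, sq_abs] at h0 h2
  rw [← div_eq_mul_inv, le_div_iff₀ (by positivity)]
  have ht2 : t ^ 2 ≤ 1 := (sq_le_one_iff_abs_le_one t).2 ht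
  have h3 : 1 + u ^ 2 ≤ 3 * (1 + (u + t) ^ 2) := by nlinarith [sq_nonneg (u + 2 * t)]
  calc ‖K (u + t)‖ * (1 + u ^ 2) ≤ ‖K (u + t)‖ * (3 * (1 + (u + t) ^ 2)) := by gcongr
    _ = 3 * (‖K (u + t)‖ + (u + t) ^ 2 * ‖K (u + t)‖) := by ring
    _ ≤ 3 * (C0 + C2) := by gcongr

theorem hasDerivAt_integral_mul_schwartz {f : ℝ → ℂ} (hf : Continuous f) {M : ℝ}
    (hM : ∀ x, ‖f x‖ ≤ M) (K : 𝓢(ℝ, ℂ)) (x : ℝ) :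
    HasDerivAt (fun x => ∫ y, f y * K (x - y))
      (∫ y, f y * SchwartzMap.derivCLM ℂ ℂ K (x - y)) x := by
  set K' := SchwartzMap.derivCLM ℂ ℂ K
  obtain ⟨C, hC⟩ := exists_norm_schwartz_near_le K'
  have hfL : MemLp f ⊤ volume := memLp_top_of_bound hf.aestronglyMeasurable M (.of_forall hM)
  have hcont : ∀ (L : 𝓢(ℝ, ℂ)) (x : ℝ), Continuous fun y => f y * L (x - y) := fun L x =>
    hf.mul (L.continuous.comp (by fun_prop))
  refine (hasDerivAt_integral_of_dominated_loc_of_deriv_le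
    (F' := fun x y => f y * K' (x - y)) (Metric.closedBall_mem_nhds x one_pos)
    (.of_forall fun x => (hcont K x).aestronglyMeasurable)
    (hfL.integrable_mul_schwartz le_top K x) (hcont K' x).aestronglyMeasurable
    (bound := fun y => M * (C * (1 + (x - y) ^ 2)⁻¹)) ?_ ?_ ?_).2
  · refine .of_forall fun y x' hx' => ?_
    rw [norm_mul]
    have h1 : |x' - x| ≤ 1 := by simpa [Real.dist_eq] using hx'
    have h2 := hC (x - y) (x' - x) h1
    rw [show x - y + (x' - x) = x' - y by ring] at h2
    exact mul_le_mul (hM y) h2 (norm_nonneg _) ((norm_nonneg _).trans (hM y))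
  · exact ((integrable_inv_one_add_sq.comp_sub_left x).const_mul C).const_mul M
  · refine .of_forall fun y x' _ => ?_
    exact ((K.hasDerivAt (x' - y)).comp_sub_const x' y).const_mul (f y)

/-- Hölder's inequality applied to `f = f * K`; this reduces pointwise questions for every `p` to
bounded functions. -/
theorem MemBernstein.exists_bound {σ : ℝ} (hσ : 0 < σ) {p : ℝ≥0∞} (hp : 1 ≤ p) {f : ℝ → ℂ}
    (hf : MemBernstein σ p f) : ∃ M : ℝ, ∀ x, ‖f x‖ ≤ M := by
  obtain ⟨χ, K, _, _, hrep⟩ := MemBernstein.exists_reproducing_kernel hσ (lt_add_one σ)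
  obtain ⟨M, hM⟩ := hf.memLp.exists_bound_integral_mul_schwartz hp K
  exact ⟨M, fun x => by rw [hrep p f hp hf x]; exact hM x⟩

theorem MemBernstein.hasSum_oversampled {σ s : ℝ} (hσ : 0 < σ) (hs : σ < s) {p : ℝ≥0∞}
    (hp : 1 ≤ p) {f : ℝ → ℂ} (hf : MemBernstein σ p f) {n : ℕ} (hn : n ≠ 0) {δ : ℝ}
    (hδ : Complex.exp (2 * π * Complex.I * δ) = (-1) ^ n) (x : ℝ) :
    HasSum (fun k : ℤ => (sincCoeff n δ k : ℂ) * f (x + π / s * (k - δ)))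
      (((π / s : ℝ) : ℂ) ^ n * iteratedDeriv n f x) := by
  obtain ⟨χ, K, hχ, hK, hrep⟩ := MemBernstein.exists_reproducing_kernel hσ hs
  have hrep := hrep p f hp hf
  obtain ⟨M, hM⟩ := hf.exists_bound hσ hp
  set D : 𝓢(ℝ, ℂ) → 𝓢(ℝ, ℂ) := fun L => SchwartzMap.derivCLM ℂ ℂ L
  have hKn : ∀ (n : ℕ) (y : ℝ), (D^[n] K) y = ((2 * π : ℝ) : ℂ)⁻¹ * bandIntegral χ s n y := by
    intro n
    induction n with
    | zero => exact hK
    | succ n ih =>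
      intro y
      rw [Function.iterate_succ_apply', SchwartzMap.derivCLM_apply, funext ih]
      exact ((bandIntegral_hasDerivAt hχ s n y).const_mul _).deriv
  have hder : ∀ n : ℕ, iteratedDeriv n f = fun x => ∫ y, f y * (D^[n] K) (x - y) := by
    intro n
    induction n with
    | zero => simpa using funext hrep
    | succ n ih =>
      funext x
      rw [iteratedDeriv_succ, ih, Function.iterate_succ_apply']
      exact (hasDerivAt_integral_mul_schwartz hf.contDiff.continuous hM _ x).deriv
  have hsum := summable_abs_sincCoeff hn hδ
  set F : ℤ → ℝ → ℂ := fun k y => (sincCoeff n δ k : ℂ) * (f y * K (x + π / s * (k - δ) - y))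
  have hFi : ∀ k, Integrable (F k) := fun k =>
    (hf.memLp.integrable_mul_schwartz hp K _).const_mul _
  -- Sum and convolution may be interchanged because `f` is bounded, `K` integrable and the
  -- coefficients absolutely summable.
  have hFs : Summable fun k => ∫ y, ‖F k y‖ := by
    refine (hsum.mul_right (M * ∫ y, ‖K y‖)).of_nonneg_of_le
      (fun k => integral_nonneg fun y => norm_nonneg _) fun k => ?_
    simp only [F, norm_mul, Complex.norm_real, Real.norm_eq_abs]
    rw [integral_const_mul]
    gcongr
    rw [← integral_sub_left_eq_self (fun y => ‖K y‖) volume (x + π / s * (k - δ)),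
      ← integral_const_mul]
    refine integral_mono ?_ ((K.integrable.comp_sub_left _).norm.const_mul M) fun y => ?_
    · simpa only [norm_mul] using (hf.memLp.integrable_mul_schwartz hp K _).norm
    · exact mul_le_mul_of_nonneg_right (hM y) (norm_nonneg _)
  have h := hasSum_integral_of_summable_integral_norm hFi hFs
  have e1 : ∀ k, ∫ y, F k y = (sincCoeff n δ k : ℂ) * f (x + π / s * (k - δ)) := fun k => by
    rw [integral_const_mul, ← hrep]
  have e2 : ∫ y, ∑' k, F k y = ((π / s : ℝ) : ℂ) ^ n * iteratedDeriv n f x := by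
    rw [hder n, ← integral_const_mul]
    congr 1 with y
    have h2 := ((hasSum_sincCoeff_mul_bandIntegral hχ (hσ.trans hs) hn hδ (x - y)).mul_left
      (f y * ((2 * π : ℝ) : ℂ)⁻¹)).tsum_eq
    have e3 : ((π / s : ℝ) : ℂ) ^ n * (f y * (((2 * π : ℝ) : ℂ)⁻¹ * bandIntegral χ s n (x - y)))
        = f y * ((2 * π : ℝ) : ℂ)⁻¹ * (((π / s : ℝ) : ℂ) ^ n * bandIntegral χ s n (x - y)) := by
      ring
    rw [hKn, e3, ← h2]
    congr 1 with k
    simp only [F]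
    rw [hK, show x + π / s * (k - δ) - y = x - y + π / s * (k - δ) by ring]
    ring
  rwa [funext e1, e2] at h

/-- The differentiation formula at the critical sampling rate. -/
theorem MemBernstein.hasSum_sincCoeff {σ : ℝ} (hσ : 0 < σ) {p : ℝ≥0∞}
    (hp : 1 ≤ p) {f : ℝ → ℂ} (hf : MemBernstein σ p f) {n : ℕ} (hn : n ≠ 0) {δ : ℝ}
    (hδ : Complex.exp (2 * π * Complex.I * δ) = (-1) ^ n) (x : ℝ) :
    HasSum (fun k : ℤ => ((σ / π : ℝ) : ℂ) ^ n *
      ((sincCoeff n δ k : ℂ) * f (x + π / σ * (k - δ)))) (iteratedDeriv n f x) := by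
  obtain ⟨M, hM⟩ := hf.exists_bound hσ hp
  have hsum := summable_abs_sincCoeff hn hδ
  have hb : ∀ (s : ℝ) (k : ℤ), ‖(sincCoeff n δ k : ℂ) * f (x + π / s * (k - δ))‖
      ≤ |sincCoeff n δ k| * M := fun s k => by
    rw [norm_mul, Complex.norm_real, Real.norm_eq_abs]
    gcongr
    exact hM _
  have hinv : Tendsto (fun s : ℝ => π / s) (𝓝[>] σ) (𝓝 (π / σ)) :=
    ((tendsto_const_nhds.div tendsto_id hσ.ne').mono_left nhdsWithin_le_nhds)
  -- The majorant `|c_k| * M` does not depend on `s`, so continuity of `f` lets the sampling rate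
  -- descend to `σ` termwise.
  have hL : Tendsto (fun s : ℝ => ∑' k : ℤ, (sincCoeff n δ k : ℂ) * f (x + π / s * (k - δ)))
      (𝓝[>] σ) (𝓝 (∑' k : ℤ, (sincCoeff n δ k : ℂ) * f (x + π / σ * (k - δ)))) := by
    refine tendsto_tsum_of_dominated_convergence (hsum.mul_right M) (fun k => ?_)
      (.of_forall fun s k => hb s k)
    refine Tendsto.const_mul _ ((hf.contDiff.continuous.tendsto _).comp ?_)
    exact (hinv.mul_const _).const_add _
  have hR : Tendsto (fun s : ℝ => ((π / s : ℝ) : ℂ) ^ n * iteratedDeriv n f x)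
      (𝓝[>] σ) (𝓝 (((π / σ : ℝ) : ℂ) ^ n * iteratedDeriv n f x)) :=
    (((Complex.continuous_ofReal.tendsto _).comp hinv).pow n).mul_const _
  have heq := tendsto_nhds_unique (hL.congr' ?_) hR
  swap
  · filter_upwards [self_mem_nhdsWithin] with s hs
    exact (hf.hasSum_oversampled hσ hs hp hn hδ x).tsum_eq
  have hS : Summable fun k : ℤ => (sincCoeff n δ k : ℂ) * f (x + π / σ * (k - δ)) :=
    .of_norm_bounded (hsum.mul_right M) (hb σ)
  have h := (heq ▸ hS.hasSum).mul_left (((σ / π : ℝ) : ℂ) ^ n)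
  rwa [← mul_assoc, ← mul_pow, ← Complex.ofReal_mul, div_mul_div_cancel₀ pi_ne_zero,
    div_self hσ.ne', Complex.ofReal_one, one_pow, one_mul] at h

/-! ### Norm estimates in `L^p`. -/

/-- Countable Minkowski inequality: the finite partial sums obey the triangle inequality, and the
norm is lower semicontinuous under pointwise limits, including `p = ∞`. -/
theorem eLpNorm_le_tsum_of_hasSum {ι : Type*} [Countable ι] {p : ℝ≥0∞} (hp : 1 ≤ p)
    {u : ι → ℝ → ℂ} (hu : ∀ i, AEStronglyMeasurable (u i) volume) {g : ℝ → ℂ}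
    (h : ∀ x, HasSum (fun i => u i x) (g x)) :
    eLpNorm g p volume ≤ ∑' i, eLpNorm (u i) p volume := by
  refine Lp.eLpNorm_le_of_ae_tendsto (u := atTop) (f := fun s : Finset ι => ∑ i ∈ s, u i)
    (.of_forall fun s => ?_) (fun s => Finset.aestronglyMeasurable_sum s fun i _ => hu i)
    (.of_forall fun x => ?_)
  · exact (eLpNorm_sum_le (fun i _ => hu i) hp).trans (ENNReal.sum_le_tsum s)
  · simp only [Finset.sum_apply]
    exact h x

/-- The `k`-th term of the differentiation formula of order `n` with shift `δ`. -/
noncomputable def sincTerm (σ : ℝ) (n : ℕ) (δ : ℝ) (f : ℝ → ℂ) (k : ℤ) (x : ℝ) : ℂ :=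
  (sincCoeff n δ k : ℂ) * f (x + π / σ * (k - δ))

theorem eLpNorm_sincTerm (σ : ℝ) (n : ℕ) (δ : ℝ) {p : ℝ≥0∞} {f : ℝ → ℂ}
    (hf : AEStronglyMeasurable f volume) (k : ℤ) :
    eLpNorm (fun x => ((σ / π : ℝ) : ℂ) ^ n * sincTerm σ n δ f k x) p volume
      = ENNReal.ofReal (|σ / π| ^ n) * ENNReal.ofReal |sincCoeff n δ k| * eLpNorm f p volume := by
  have h1 : (fun x => ((σ / π : ℝ) : ℂ) ^ n * sincTerm σ n δ f k x)
      = (((σ / π : ℝ) : ℂ) ^ n * (sincCoeff n δ k : ℂ)) • (f ∘ fun x => x + π / σ * (k - δ)) := by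
    funext x
    simp [sincTerm, mul_assoc]
  rw [h1, eLpNorm_const_smul,
    eLpNorm_comp_measurePreserving hf (measurePreserving_add_right volume _), enorm_mul]
  congr 2
  · rw [← ofReal_norm, norm_pow, Complex.norm_real, Real.norm_eq_abs]
  · rw [← ofReal_norm, Complex.norm_real, Real.norm_eq_abs]

theorem tsum_eLpNorm_sincTerm {σ : ℝ} (hσ : 0 < σ) {n : ℕ} (hn : n ≠ 0) {δ : ℝ}
    (hδ : Complex.exp (2 * π * Complex.I * δ) = (-1) ^ n) {p : ℝ≥0∞} {f : ℝ → ℂ}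
    (hf : AEStronglyMeasurable f volume) :
    ∑' k, eLpNorm (fun x => ((σ / π : ℝ) : ℂ) ^ n * sincTerm σ n δ f k x) p volume
      = ENNReal.ofReal (σ ^ n) * eLpNorm f p volume := by
  simp_rw [eLpNorm_sincTerm σ n δ hf]
  rw [ENNReal.tsum_mul_right, ENNReal.tsum_mul_left,
    ← ENNReal.ofReal_tsum_of_nonneg (fun k => abs_nonneg _) (summable_abs_sincCoeff hn hδ),
    tsum_abs_sincCoeff hn hδ, ← ENNReal.ofReal_mul (by positivity), ← mul_pow,
    abs_of_pos (by positivity), div_mul_cancel₀ _ pi_ne_zero]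

theorem aestronglyMeasurable_sincTerm (σ : ℝ) (n : ℕ) (δ : ℝ) {f : ℝ → ℂ} (hf : Continuous f)
    (k : ℤ) : AEStronglyMeasurable (fun x => ((σ / π : ℝ) : ℂ) ^ n * sincTerm σ n δ f k x)
      volume := by
  unfold sincTerm
  exact (by fun_prop : Continuous _).aestronglyMeasurable

theorem MemBernstein.eLpNorm_iteratedDeriv_le {σ : ℝ} (hσ : 0 < σ) {p : ℝ≥0∞}
    (hp : 1 ≤ p) {f : ℝ → ℂ} (hf : MemBernstein σ p f) (n : ℕ) :
    eLpNorm (iteratedDeriv n f) p volume ≤ ENNReal.ofReal (σ ^ n) * eLpNorm f p volume := by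
  rcases eq_or_ne n 0 with rfl | hn
  · simp
  obtain ⟨δ, hδ⟩ : ∃ δ : ℝ, Complex.exp (2 * π * Complex.I * δ) = (-1) ^ n := by
    -- The shift `n / 2` satisfies the node condition for both parities at once.
    refine ⟨n / 2, ?_⟩
    rw [← Complex.exp_pi_mul_I, ← Complex.exp_nat_mul]
    congr 1
    push_cast
    ring
  rw [← tsum_eLpNorm_sincTerm hσ hn hδ hf.memLp.1]
  exact eLpNorm_le_tsum_of_hasSum hp
    (aestronglyMeasurable_sincTerm σ n δ hf.contDiff.continuous)
    fun x => hf.hasSum_sincCoeff hσ hp hn hδ x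

theorem MemBernstein.memLp_iteratedDeriv {σ : ℝ} (hσ : 0 < σ) {p : ℝ≥0∞}
    (hp : 1 ≤ p) {f : ℝ → ℂ} (hf : MemBernstein σ p f) (n : ℕ) :
    MemLp (iteratedDeriv n f) p volume :=
  ⟨(hf.contDiff.continuous_iteratedDeriv n (by exact_mod_cast le_top)).aestronglyMeasurable,
    (hf.eLpNorm_iteratedDeriv_le hσ hp n).trans_lt
      (ENNReal.mul_lt_top ENNReal.ofReal_lt_top hf.memLp.2)⟩

/-- The error of a finite partial sum is the series over the complementary indices, bounded by the
tail of a convergent series of norms. -/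
theorem MemBernstein.tendsto_eLpNorm_sum_sincTerm {σ : ℝ} (hσ : 0 < σ) {p : ℝ≥0∞}
    (hp : 1 ≤ p) {f : ℝ → ℂ} (hf : MemBernstein σ p f) {n : ℕ} (hn : n ≠ 0) {δ : ℝ}
    (hδ : Complex.exp (2 * π * Complex.I * δ) = (-1) ^ n) :
    Tendsto (fun s : Finset ℤ => eLpNorm (fun x : ℝ => ((σ / π : ℝ) : ℂ) ^ n *
      (∑ k ∈ s, sincTerm σ n δ f k x) - iteratedDeriv n f x) p volume) atTop (𝓝 0) := by
  have hm := aestronglyMeasurable_sincTerm σ n δ hf.contDiff.continuous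
  have hfin := tsum_eLpNorm_sincTerm hσ hn hδ (p := p) hf.memLp.1
  have htail := ENNReal.tendsto_tsum_compl_atTop_zero
    (hfin.trans_ne (ENNReal.mul_lt_top ENNReal.ofReal_lt_top hf.memLp.2).ne)
  refine tendsto_of_tendsto_of_tendsto_of_le_of_le tendsto_const_nhds htail
    (fun s => zero_le) fun s => ?_
  have e : (fun x : ℝ => ((σ / π : ℝ) : ℂ) ^ n * (∑ k ∈ s, sincTerm σ n δ f k x)
      - iteratedDeriv n f x) = -fun x => iteratedDeriv n f x
        - ∑ k ∈ s, ((σ / π : ℝ) : ℂ) ^ n * sincTerm σ n δ f k x := by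
    funext x
    simp [Finset.mul_sum]
  rw [e, eLpNorm_neg]
  refine eLpNorm_le_tsum_of_hasSum (ι := {k : ℤ // k ∉ s}) hp (fun k => hm k) fun x => ?_
  rw [Finset.hasSum_compl_iff s (f := fun k : ℤ => ((σ / π : ℝ) : ℂ) ^ n * sincTerm σ n δ f k x),
    sub_add_cancel]
  exact hf.hasSum_sincCoeff hσ hp hn hδ x

/-! ### Translation to the stated coefficients. -/

theorem neg_one_zpow_mul_self (j : ℤ) : ((-1 : ℂ) ^ j) * (-1) ^ j = 1 := by
  rw [← mul_zpow]
  simp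

theorem oddTerm_eq_sincTerm (σ : ℝ) (m : ℕ) (f : ℝ → ℂ) (k : ℤ) (x : ℝ) :
    oddTerm σ m f k x = sincTerm σ (2 * m - 1) (1 / 2) f k x := by
  unfold oddTerm coeffA sincTerm sincCoeff
  push_cast
  rw [← mul_assoc, neg_one_zpow_mul_self, one_mul]

theorem evenTerm_eq_sincTerm (σ : ℝ) (m : ℕ) (f : ℝ → ℂ) (k : ℤ) (x : ℝ) :
    evenTerm σ m f k x = sincTerm σ (2 * m) 0 f k x := by
  unfold evenTerm coeffB sincTerm sincCoeff
  rcases eq_or_ne k 0 with rfl | hk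
  -- At `k = 0` the outer sign `-1` turns `(-1)^(m+1)` into `(-1)^m`, the sign of `sinc⁽²ᵐ⁾(0)`.
  · rw [if_pos rfl, Int.cast_zero, sub_zero, iteratedDeriv_even_normSinc_zero]
    push_cast
    rw [pow_succ]
    simp
  · rw [if_neg hk, zero_sub, sub_zero]
    push_cast
    rw [← mul_assoc, neg_one_zpow_mul_self, one_mul]

theorem exp_two_pi_I_mul_half (m : ℕ) (hm : 1 ≤ m) :
    Complex.exp (2 * π * Complex.I * ((1 / 2 : ℝ) : ℂ)) = (-1) ^ (2 * m - 1) := by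
  rw [Odd.neg_one_pow ⟨m - 1, by omega⟩, ← Complex.exp_pi_mul_I]
  congr 1
  push_cast
  ring

theorem exp_two_pi_I_mul_zero (m : ℕ) :
    Complex.exp (2 * π * Complex.I * ((0 : ℝ) : ℂ)) = (-1) ^ (2 * m) := by
  simp

theorem MemBernstein.summable_sincTerm_and_eq {σ : ℝ} (hσ : 0 < σ) {p : ℝ≥0∞}
    (hp : 1 ≤ p) {f : ℝ → ℂ} (hf : MemBernstein σ p f) {n : ℕ} (hn : n ≠ 0) {δ : ℝ}
    (hδ : Complex.exp (2 * π * Complex.I * δ) = (-1) ^ n) (x : ℝ) :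
    Summable (fun k : ℤ => sincTerm σ n δ f k x) ∧
      iteratedDeriv n f x = ((σ / π : ℝ) : ℂ) ^ n * ∑' k : ℤ, sincTerm σ n δ f k x := by
  have h := hf.hasSum_sincCoeff hσ hp hn hδ x
  have hc : ((σ / π : ℝ) : ℂ) ^ n ≠ 0 :=
    pow_ne_zero _ (by exact_mod_cast (div_pos hσ pi_pos).ne')
  exact ⟨(summable_mul_left_iff hc).1 h.summable, by rw [← tsum_mul_left]; exact h.tsum_eq.symm⟩

theorem mainTheorem10 (σ : ℝ) (hσ : 0 < σ) :
    -- pointwise formulas for bounded functions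
    (∀ f : ℝ → ℂ, MemBernstein σ ∞ f → ∀ m : ℕ, 1 ≤ m → ∀ x : ℝ,
      (Summable (fun k : ℤ => oddTerm σ m f k x) ∧
        iteratedDeriv (2 * m - 1) f x
          = ((σ / π : ℝ) : ℂ) ^ (2 * m - 1) * ∑' k : ℤ, oddTerm σ m f k x) ∧
      (Summable (fun k : ℤ => evenTerm σ m f k x) ∧
        iteratedDeriv (2 * m) f x
          = ((σ / π : ℝ) : ℂ) ^ (2 * m) * ∑' k : ℤ, evenTerm σ m f k x)) ∧
    -- convergence in `L^p` and the Bernstein inequality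
    (∀ p : ℝ≥0∞, 1 ≤ p → ∀ f : ℝ → ℂ, MemBernstein σ p f →
      (∀ m : ℕ, 1 ≤ m →
        Tendsto (fun s : Finset ℤ => eLpNorm (fun x : ℝ =>
            ((σ / π : ℝ) : ℂ) ^ (2 * m - 1) * (∑ k ∈ s, oddTerm σ m f k x)
              - iteratedDeriv (2 * m - 1) f x) p volume) atTop (𝓝 0) ∧
        Tendsto (fun s : Finset ℤ => eLpNorm (fun x : ℝ =>
            ((σ / π : ℝ) : ℂ) ^ (2 * m) * (∑ k ∈ s, evenTerm σ m f k x)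
              - iteratedDeriv (2 * m) f x) p volume) atTop (𝓝 0)) ∧
      (∀ n : ℕ, MemLp (iteratedDeriv n f) p volume ∧
        eLpNorm (iteratedDeriv n f) p volume
          ≤ ENNReal.ofReal (σ ^ n) * eLpNorm f p volume)) := by

  refine ⟨fun f hf m hm x => ?_, fun p hp f hf => ⟨fun m hm => ?_, fun n =>
    ⟨hf.memLp_iteratedDeriv hσ hp n, hf.eLpNorm_iteratedDeriv_le hσ hp n⟩⟩⟩
  · simp_rw [oddTerm_eq_sincTerm, evenTerm_eq_sincTerm]
    exact ⟨hf.summable_sincTerm_and_eq hσ le_top (by omega) (exp_two_pi_I_mul_half m hm) x,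
      hf.summable_sincTerm_and_eq hσ le_top (by omega) (exp_two_pi_I_mul_zero m) x⟩
  · simp_rw [oddTerm_eq_sincTerm, evenTerm_eq_sincTerm]
    exact ⟨hf.tendsto_eLpNorm_sum_sincTerm hσ hp (by omega) (exp_two_pi_I_mul_half m hm),
      hf.tendsto_eLpNorm_sum_sincTerm hσ hp (by omega) (exp_two_pi_I_mul_zero m)⟩
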